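/- Let $m$ and $n$ be coprime positive integers. **Billiard symbol.** In a rectangle of width $n$ and height $m$ with lower left corner at the origin, a ball starts at $(0,0)$ and moves at $45^\circ$ to the sides, reflecting off each side it hits, until it first reaches a corner again, where the path ends. A bounce along the base (the side on the $x$-axis; the start and the end of the path are not bounces) is positive if the ball is moving from left to right as it bounces, and negative if it is moving from right to left. Let $\left(\frac{m}{n}\right)\in\{1,-1\}$ be the product of the signs of all bounces along the base (an empty product is $1$). **Puzzle.** Consider a checkerboard with $m-1$ rows and $n-1$ columns whose lower left square is dark, and put pebbles on all light squares of the bottom row. A solution is a set of dark squares, on which checkers are put, such that the light squares with an odd number of checkers on the squares sharing a side with them are precisely the squares with pebbles. Then this puzzle has exactly one solution, and if $s$ is the number of checkers in it, then \[ \left(\frac{m}{n}\right) = (-1)^s . \] -/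

import Mathlib

/-! ### Arithmetic billiards -/

/-- A moving ball: its position `(x, y)` at an integer time and its direction `(dx, dy)` of
motion right after that time (that is, after a possible bounce); `dx, dy` are `1` or `-1`. -/
structure Ball where
  x : ℤ
  y : ℤ
  dx : ℤ
  dy : ℤ

/-- The ball in the lower left corner `(0, 0)`, moving up and to the right. -/
def Ball.start : Ball := ⟨0, 0, 1, 1⟩

/-- One unit of time in a rectangle of height `m` and width `n`: the ball moves along one diagonal
of a unit square; if it is then on a vertical (horizontal) side of the rectangle, its horizontal
(vertical) direction is reversed. All bounces occur at integer times. -/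
def Ball.step (m n : ℕ) (b : Ball) : Ball where
  x := b.x + b.dx
  y := b.y + b.dy
  dx := if b.x + b.dx = 0 ∨ b.x + b.dx = n then -b.dx else b.dx
  dy := if b.y + b.dy = 0 ∨ b.y + b.dy = m then -b.dy else b.dy

/-- The ball at time `t`, in a rectangle of height `m` and width `n`. -/
def ballAt (m n t : ℕ) : Ball := (Ball.step m n)^[t] Ball.start

/-- The ball is in one of the four corners of the rectangle. -/
def Ball.AtCorner (m n : ℕ) (b : Ball) : Prop :=
  (b.x = 0 ∨ b.x = n) ∧ (b.y = 0 ∨ b.y = m)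

/-- The time at which the path is completed: the first positive time at which the ball is in a
corner (for positive `m` and `n` there is such a time). -/
noncomputable def endTime (m n : ℕ) : ℕ :=
  sInf {t : ℕ | 0 < t ∧ (ballAt m n t).AtCorner m n}

/-- The times of the bounces along the base (the `x`-axis); neither the start nor the end of the
path is a bounce. -/
noncomputable def baseBounceTimes (m n : ℕ) : Finset ℕ :=
  (Finset.Ioo 0 (endTime m n)).filter fun t => (ballAt m n t).y = 0

/-- The sign of a bounce along the base: positive if the ball moves from left to right as it
bounces, negative if it moves from right to left. (The horizontal direction does not change at
such a bounce.) -/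
def bounceSign (m n t : ℕ) : ℤ := if 0 < (ballAt m n t).dx then 1 else -1

/-- The billiard symbol `(m|n)`: the product of the signs of the bounces along the base if `m` and
`n` are coprime, and `0` otherwise. -/
noncomputable def billiardSymbol (m n : ℕ) : ℤ :=
  if Nat.Coprime m n then ∏ t ∈ baseBounceTimes m n, bounceSign m n t else 0

/-! ### Parity checkers -/

/-- The squares `(row, column)` of a board with `r` rows and `c` columns; rows are counted from the
bottom and columns from the left, both starting at `0`. -/
abbrev Square (r c : ℕ) : Type := Fin r × Fin c

/-- The dark squares of the checkerboard whose lower left square is dark. -/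
abbrev IsDark {r c : ℕ} (q : Square r c) : Prop := Even (q.1.val + q.2.val)

/-- The light squares. -/
abbrev IsLight {r c : ℕ} (q : Square r c) : Prop := ¬ IsDark q

/-- Two squares are neighbours if they share a side. -/
abbrev Neighbour {r c : ℕ} (p q : Square r c) : Prop :=
  (p.1 = q.1 ∧ (p.2.val + 1 = q.2.val ∨ q.2.val + 1 = p.2.val)) ∨
  (p.2 = q.2 ∧ (p.1.val + 1 = q.1.val ∨ q.1.val + 1 = p.1.val))

/-- The set `C` of checkers solves the puzzle with pebbles on the set `P` of light squares: all
checkers are on dark squares, and the light squares with an odd number of neighbouring checkers are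
precisely those with pebbles. -/
def IsSolution {r c : ℕ} (P C : Finset (Square r c)) : Prop :=
  (∀ q ∈ C, IsDark q) ∧
  ∀ q : Square r c, IsLight q → (Odd (C.filter fun d => Neighbour q d).card ↔ q ∈ P)

/-- The puzzle with pebbles on all light squares of the bottom row. -/
def bottomRowPuzzle (r c : ℕ) : Finset (Square r c) :=
  Finset.univ.filter fun q => IsLight q ∧ q.1.val = 0

/-! Each coordinate of the ball is a triangle wave in time, so the path ends at time `m * n`, the
bounces along the base occur at the multiples of `2 * m`, and the bounce at time `t` has the sign
`(-1) ^ (t / n)`.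

Modulo `2` the puzzle is the discrete wave equation, `F` summing to `0` over the four neighbours of
every light point, with boundary values `1` on the base and `0` on the other sides. The difference
of two solutions extends by reflections to the whole lattice. In the coordinates `x = a + b`,
`y = a - b` it is a sum `g a + g b`, and the four sides make `g` periodic with the coprime periods
`m` and `n`, so it vanishes.

For existence, label every segment of the path of the ball by the parity of the number of preceding
bounces along the base, and put checkers where segments with different labels cross. To count them,
note that the lines of slope `1` through a row and its mirror image carry every label of the
unfolded path exactly once. Hence each row contributes the same constant, up to the labels at its
bounces at the vertical sides. The latter add up to the number of pairs of a bounce along the base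
and a later bounce at a vertical side. The other pairs of such bounces give the exponent of the
symbol, and the number of all pairs has the parity of the sum of the constants.
-/

open Finset Function

/-! ### The path of the ball -/

/-- The triangle wave of period `2 * n`: the point of `[0, n]` obtained from `t` by reflections in
the multiples of `n`. It describes each coordinate of the ball as a function of time. -/
def triangleWave (n : ℕ) (t : ℤ) : ℤ := if Even (t / n) then t % n else n - t % n

section TriangleWave

variable {n : ℕ}

lemma triangleWave_mul_add (q : ℤ) {r : ℤ} (hr₀ : 0 ≤ r) (hr : r ≤ n) :
    triangleWave n (n * q + r) = if Even q then r else n - r := by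
  rcases hr.eq_or_lt with rfl | hr'
  · rcases hr₀.eq_or_lt with h₀ | h₀
    · simp [triangleWave, ← h₀]
    · rw [← mul_add_one, triangleWave, Int.mul_ediv_cancel_left _ h₀.ne']
      simp only [Int.mul_emod_right, Int.even_add_one, sub_zero, sub_self, ite_not]
  · have hdiv : ((n : ℤ) * q + r) / n = q := by
      rw [Int.mul_add_ediv_left _ _ (hr₀.trans_lt hr').ne', Int.ediv_eq_zero_of_lt hr₀ hr',
        add_zero]
    rw [triangleWave, hdiv, Int.mul_add_emod_self_left, Int.emod_eq_of_lt hr₀ hr']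

lemma triangleWave_of_mem_Icc {t : ℤ} (h₀ : 0 ≤ t) (h : t ≤ n) : triangleWave n t = t := by
  simpa using triangleWave_mul_add 0 h₀ h

lemma triangleWave_mem_Icc (hn : 0 < n) (t : ℤ) :
    0 ≤ triangleWave n t ∧ triangleWave n t ≤ n := by
  have := Int.emod_nonneg t (b := n) (by omega)
  have := Int.emod_lt_of_pos t (b := n) (by omega)
  unfold triangleWave
  split_ifs <;> omega

lemma two_mul_dvd_triangleWave_sub_or_add (n : ℕ) (t : ℤ) :
    (2 * n : ℤ) ∣ triangleWave n t - t ∨ (2 * n : ℤ) ∣ triangleWave n t + t := by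
  have ht := Int.mul_ediv_add_emod t n
  unfold triangleWave
  split_ifs with h
  · obtain ⟨c, hc⟩ := h
    exact .inl ⟨-c, by rw [hc] at ht; linear_combination ht⟩
  · obtain ⟨c, hc⟩ := Int.not_even_iff_odd.1 h
    exact .inr ⟨c + 1, by rw [hc] at ht; linear_combination -ht⟩

lemma eq_of_two_mul_dvd_sub_or_add {s t : ℤ} (hs₀ : 0 ≤ s) (hs : s ≤ n) (ht₀ : 0 ≤ t)
    (ht : t ≤ n) (h : (2 * n : ℤ) ∣ s - t ∨ (2 * n : ℤ) ∣ s + t) : s = t := by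
  by_contra hst
  rcases h with h | h
  · rcases lt_or_gt_of_ne hst with hlt | hlt
    · have := Int.le_of_dvd (by omega) ((dvd_sub_comm).1 h)
      omega
    · have := Int.le_of_dvd (by omega) h
      omega
  · have := Int.le_of_dvd (by omega) h
    omega

lemma dvd_sub_or_dvd_add_trans {d a b c : ℤ} (hab : d ∣ a - b ∨ d ∣ a + b)
    (hbc : d ∣ b - c ∨ d ∣ b + c) : d ∣ a - c ∨ d ∣ a + c := by
  rcases hab with hab | hab <;> rcases hbc with hbc | hbc
  · exact .inl ((by ring : a - b + (b - c) = a - c) ▸ dvd_add hab hbc)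
  · exact .inr ((by ring : a - b + (b + c) = a + c) ▸ dvd_add hab hbc)
  · exact .inr ((by ring : a + b - (b - c) = a + c) ▸ dvd_sub hab hbc)
  · exact .inl ((by ring : a + b - (b + c) = a - c) ▸ dvd_sub hab hbc)

lemma triangleWave_eq_triangleWave_iff (hn : 0 < n) {s t : ℤ} :
    triangleWave n s = triangleWave n t ↔ (2 * n : ℤ) ∣ s - t ∨ (2 * n : ℤ) ∣ s + t := by
  have hs := two_mul_dvd_triangleWave_sub_or_add n s
  have ht := two_mul_dvd_triangleWave_sub_or_add n t
  have ⟨hs₀, hsn⟩ := triangleWave_mem_Icc hn s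
  have ⟨ht₀, htn⟩ := triangleWave_mem_Icc hn t
  refine ⟨fun h => ?_, fun h => eq_of_two_mul_dvd_sub_or_add hs₀ hsn ht₀ htn ?_⟩
  · rw [h, dvd_sub_comm, add_comm] at hs
    exact dvd_sub_or_dvd_add_trans hs ht
  · rw [dvd_sub_comm, add_comm] at ht
    exact dvd_sub_or_dvd_add_trans (dvd_sub_or_dvd_add_trans hs h) ht

lemma triangleWave_eq_iff (hn : 0 < n) {t x : ℤ} (hx₀ : 0 ≤ x) (hx : x ≤ n) :
    triangleWave n t = x ↔ (2 * n : ℤ) ∣ t - x ∨ (2 * n : ℤ) ∣ t + x := by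
  rw [← triangleWave_eq_triangleWave_iff hn, triangleWave_of_mem_Icc hx₀ hx]

lemma triangleWave_eq_zero_iff (hn : 0 < n) (t : ℤ) :
    triangleWave n t = 0 ↔ (2 * n : ℤ) ∣ t := by
  simp [triangleWave_eq_iff hn]

lemma even_triangleWave_iff (n : ℕ) (t : ℤ) : Even (triangleWave n t) ↔ Even t := by
  rcases two_mul_dvd_triangleWave_sub_or_add n t with h | h
  · exact Int.even_sub.1 (even_iff_two_dvd.2 (dvd_of_mul_right_dvd h))
  · exact Int.even_add.1 (even_iff_two_dvd.2 (dvd_of_mul_right_dvd h))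

lemma dvd_triangleWave_iff (n : ℕ) (t : ℤ) : (n : ℤ) ∣ triangleWave n t ↔ (n : ℤ) ∣ t := by
  rcases two_mul_dvd_triangleWave_sub_or_add n t with h | h
  · exact dvd_iff_dvd_of_dvd_sub (dvd_of_mul_left_dvd h)
  · rw [← dvd_neg (b := t)]
    exact dvd_iff_dvd_of_dvd_sub (by simpa using dvd_of_mul_left_dvd h)

lemma triangleWave_eq_zero_or_eq_iff (hn : 0 < n) (t : ℤ) :
    triangleWave n t = 0 ∨ triangleWave n t = n ↔ (n : ℤ) ∣ t := by
  have ⟨h₀, hle⟩ := triangleWave_mem_Icc hn t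
  rw [← dvd_triangleWave_iff]
  refine ⟨?_, fun hdvd => ?_⟩
  · rintro (h | h) <;> simp [h]
  · exact h₀.eq_or_lt.imp Eq.symm fun hpos => hle.antisymm (Int.le_of_dvd hpos hdvd)

lemma triangleWave_add_one (hn : 0 < n) (t : ℤ) :
    triangleWave n (t + 1) = triangleWave n t + if Even (t / n) then 1 else -1 := by
  have hr₀ := Int.emod_nonneg t (b := n) (by omega)
  have hr := Int.emod_lt_of_pos t (b := n) (by omega)
  nth_rw 1 [← Int.mul_ediv_add_emod t n]
  rw [add_assoc, triangleWave_mul_add _ (by omega) (by omega), triangleWave]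
  split_ifs <;> ring

lemma triangleWave_add_one_of_dvd (hn : 0 < n) {t : ℤ} (h : (n : ℤ) ∣ t) :
    triangleWave n (t + 1) = triangleWave n (t - 1) := by
  obtain ⟨q, rfl⟩ := h
  rw [triangleWave_mul_add q zero_le_one (by omega),
    show (n : ℤ) * q - 1 = n * (q - 1) + (n - 1) by ring,
    triangleWave_mul_add _ (by omega) (by omega)]
  simp only [Int.even_sub_one, ite_not, sub_sub_cancel]

lemma triangleWave_add_one_add_sub_one (hn : 0 < n) {t : ℤ} (h : ¬ (n : ℤ) ∣ t) :
    triangleWave n (t + 1) + triangleWave n (t - 1) = 2 * triangleWave n t := by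
  have hr := Int.emod_lt_of_pos t (b := n) (by omega)
  have hr₀ : 0 < t % n := (Int.emod_pos_of_not_dvd h).resolve_left (by omega)
  rw [← Int.mul_ediv_add_emod t n, add_assoc, add_sub_assoc,
    triangleWave_mul_add _ (by omega) (by omega), triangleWave_mul_add _ (by omega) (by omega),
    triangleWave_mul_add _ (by omega) (by omega)]
  split_ifs <;> ring

end TriangleWave

section Billiard

variable {m n : ℕ}

lemma ballAt_eq (hm : 0 < m) (hn : 0 < n) (t : ℕ) :
    ballAt m n t = ⟨triangleWave n t, triangleWave m t,
      triangleWave n (t + 1) - triangleWave n t, triangleWave m (t + 1) - triangleWave m t⟩ := by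
  have direction {n : ℕ} (hn : 0 < n) (t : ℤ) :
      (if triangleWave n (t + 1) = 0 ∨ triangleWave n (t + 1) = n
        then -(triangleWave n (t + 1) - triangleWave n t)
        else triangleWave n (t + 1) - triangleWave n t) =
      triangleWave n (t + 1 + 1) - triangleWave n (t + 1) := by
    simp only [triangleWave_eq_zero_or_eq_iff hn]
    split_ifs with h
    · rw [triangleWave_add_one_of_dvd hn h, add_sub_cancel_right, neg_sub]
    · have := triangleWave_add_one_add_sub_one hn h
      rw [add_sub_cancel_right] at this
      linear_combination -this
  induction t with
  | zero =>
    have initial {n : ℕ} (hn : 0 < n) : triangleWave n 0 = 0 ∧ triangleWave n 1 = 1 :=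
      ⟨triangleWave_of_mem_Icc le_rfl (by omega), triangleWave_of_mem_Icc (by omega) (by omega)⟩
    simp [ballAt, Ball.start, initial hm, initial hn]
  | succ t ih =>
    rw [show ballAt m n (t + 1) = Ball.step m n (ballAt m n t) from iterate_succ_apply' _ _ _, ih]
    simp only [Ball.step, add_sub_cancel, direction hm, direction hn, Nat.cast_succ]

lemma endTime_eq (hm : 0 < m) (hn : 0 < n) (hmn : m.Coprime n) : endTime m n = m * n := by
  have h : {t : ℕ | 0 < t ∧ (ballAt m n t).AtCorner m n} = {t : ℕ | 0 < t ∧ m * n ∣ t} := by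
    ext t
    simp only [Ball.AtCorner, ballAt_eq hm hn, triangleWave_eq_zero_or_eq_iff hm,
      triangleWave_eq_zero_or_eq_iff hn, Set.mem_ofPred_eq, Int.natCast_dvd_natCast]
    exact and_congr_right fun _ => ⟨fun h => hmn.mul_dvd_of_dvd_of_dvd h.2 h.1,
      fun h => ⟨dvd_of_mul_left_dvd h, dvd_of_mul_right_dvd h⟩⟩
  rw [endTime, h]
  exact IsLeast.csInf_eq ⟨⟨by positivity, dvd_rfl⟩, fun t ht => Nat.le_of_dvd ht.1 ht.2⟩

lemma bounceSign_eq (hm : 0 < m) (hn : 0 < n) (t : ℕ) :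
    bounceSign m n t = (-1) ^ (t / n) := by
  simp only [bounceSign, ballAt_eq hm hn, triangleWave_add_one hn, add_sub_cancel_left,
    neg_one_pow_eq_ite]
  norm_cast
  split_ifs <;> simp_all

/-- The multiples of `a` strictly between `0` and `N`. With `N = m * n`, the ball bounces along the
base at the multiples of `2 * m`, and at the vertical sides at the multiples of `n`. -/
def multiplesBelow (a N : ℕ) : Finset ℕ := (Ioo 0 N).filter (a ∣ ·)

lemma mem_multiplesBelow {a N t : ℕ} : t ∈ multiplesBelow a N ↔ (0 < t ∧ t < N) ∧ a ∣ t := by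
  rw [multiplesBelow, mem_filter, mem_Ioo]

lemma baseBounceTimes_eq (hm : 0 < m) (hn : 0 < n) (hmn : m.Coprime n) :
    baseBounceTimes m n = multiplesBelow (2 * m) (m * n) := by
  simp only [baseBounceTimes, multiplesBelow, endTime_eq hm hn hmn, ballAt_eq hm hn,
    triangleWave_eq_zero_iff hm]
  norm_cast

theorem billiardSymbol_eq (hm : 0 < m) (hn : 0 < n) (hmn : m.Coprime n) :
    billiardSymbol m n = (-1) ^ ∑ t ∈ multiplesBelow (2 * m) (m * n), t / n := by
  rw [billiardSymbol, if_pos hmn, baseBounceTimes_eq hm hn hmn, ← prod_pow_eq_pow_sum]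
  exact prod_congr rfl fun t _ => bounceSign_eq hm hn t

end Billiard

/-! ### Uniqueness -/

section WaveEquation

/-- The sum of the values of `F` at the four neighbours of a lattice point. Modulo `2` it is the
defect of the discrete wave equation. -/
def neighbourSum {R : Type*} [Add R] (F : ℤ → ℤ → R) (x y : ℤ) : R :=
  F (x + 1) y + F (x - 1) y + F x (y + 1) + F x (y - 1)

lemma eq_const_of_periodic_of_isCoprime {A : Type*} {g : ℤ → A} {p q : ℤ} (hpq : IsCoprime p q)
    (hp : Periodic g p) (hq : Periodic g q) (a : ℤ) : g a = g 0 := by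
  obtain ⟨u, v, huv⟩ := hpq
  have hone : Periodic g 1 := huv ▸ (hp.int_mul u).add_period (hq.int_mul v)
  simpa using (hone.int_mul a) 0

lemma eq_add_sub_of_mixed_difference_eq_zero {A : Type*} [AddCommGroup A] {G : ℤ → ℤ → A}
    (h : ∀ a b, G (a + 1) (b + 1) + G a b = G (a + 1) b + G a (b + 1)) (a b : ℤ) :
    G a b = G a 0 + G 0 b - G 0 0 := by
  have step (a : ℤ) : Periodic (fun b => G (a + 1) b - G a b) 1 := fun b =>
    sub_eq_sub_iff_add_eq_add.2 (by rw [h, add_comm])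
  have hrow (b : ℤ) : Periodic (fun a => G a b - G a 0) 1 := fun a => by
    have := ((step a).int_mul b) 0
    simp only [mul_one, zero_add, Int.cast_id] at this
    exact sub_eq_sub_iff_sub_eq_sub.1 this
  have := ((hrow b).int_mul a) 0
  simp only [mul_one, zero_add, Int.cast_id] at this
  rw [sub_eq_iff_eq_add] at this
  rw [this]
  abel

variable {R : Type*} [CommRing R] [CharP R 2]

lemma apply_add_sub_eq_of_neighbourSum_eq_zero {F : ℤ → ℤ → R}
    (hF : ∀ x y, Odd (x + y) → neighbourSum F x y = 0) (hbase : ∀ x, F x 0 = 0) (a b : ℤ) :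
    F (a + b) (a - b) = F a a + F b b := by
  have hmixed (a b : ℤ) : F (a + 1 + (b + 1)) (a + 1 - (b + 1)) + F (a + b) (a - b) =
      F (a + 1 + b) (a + 1 - b) + F (a + (b + 1)) (a - (b + 1)) := by
    have h := hF (a + b + 1) (a - b) ⟨a, by ring⟩
    rw [neighbourSum, add_assoc, CharTwo.add_eq_zero] at h
    convert h using 3 <;> ring
  have hG := eq_add_sub_of_mixed_difference_eq_zero (G := fun a b => F (a + b) (a - b)) hmixed
  simp only [add_zero, sub_zero, zero_add, zero_sub, hbase] at hG
  have hdiag : F b b = F b (-b) := by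
    rw [← CharTwo.add_eq_zero, ← hG, sub_self, hbase]
  rw [hG, hdiag]

lemma eq_zero_of_neighbourSum_eq_zero_of_lines {F : ℤ → ℤ → R} {p q : ℤ} (hpq : IsCoprime p q)
    (hF : ∀ x y, Odd (x + y) → neighbourSum F x y = 0) (hleft : ∀ y, F 0 y = 0)
    (hright : ∀ y, F p y = 0) (hbase : ∀ x, F x 0 = 0) (htop : ∀ x, F x q = 0)
    {x y : ℤ} (hxy : Even (x + y)) : F x y = 0 := by
  have hsum := apply_add_sub_eq_of_neighbourSum_eq_zero hF hbase
  have hneg (a : ℤ) : F (-a) (-a) = F a a := by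
    rw [← CharTwo.add_eq_zero, ← hsum, neg_add_cancel, hleft]
  have hp : Periodic (fun a => F a a) p := fun a => by
    change F (a + p) (a + p) = F a a
    rw [← hneg a, ← CharTwo.add_eq_zero, ← hsum, add_neg_cancel_comm, hright]
  have hq : Periodic (fun a => F a a) q := fun a => by
    change F (a + q) (a + q) = F a a
    rw [← CharTwo.add_eq_zero, ← hsum, add_sub_cancel_left, htop]
  have hdiag (a : ℤ) : F a a = 0 :=
    (eq_const_of_periodic_of_isCoprime hpq hp hq a).trans (hleft 0)
  obtain ⟨a, ha⟩ := hxy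
  have h := hsum a (x - a)
  rwa [hdiag, hdiag, add_zero, add_sub_cancel, ← sub_add, show a - x + a = y by omega] at h

variable {m n : ℕ}

lemma apply_triangleWave_add_one_add_sub_one {A : Type*} [AddCommMonoid A] (hn : 0 < n) {t : ℤ}
    (ht : ¬ (n : ℤ) ∣ t) (g : ℤ → A) :
    g (triangleWave n (t + 1)) + g (triangleWave n (t - 1)) =
      g (triangleWave n t + 1) + g (triangleWave n t - 1) := by
  have hsum := triangleWave_add_one_add_sub_one hn ht
  have hnext := triangleWave_add_one hn t
  split_ifs at hnext
  · rw [hnext, show triangleWave n (t - 1) = triangleWave n t - 1 by omega]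
  · rw [hnext, show triangleWave n (t - 1) = triangleWave n t + 1 by omega, add_comm,
      sub_eq_add_neg]

lemma neighbourSum_triangleWave (hm : 0 < m) (hn : 0 < n) {f : ℤ → ℤ → R}
    (hleft : ∀ y, f 0 y = 0) (hright : ∀ y, f n y = 0) (hbase : ∀ x, f x 0 = 0)
    (htop : ∀ x, f x m = 0) (x y : ℤ) :
    neighbourSum (fun x y => f (triangleWave n x) (triangleWave m y)) x y =
      if (n : ℤ) ∣ x ∨ (m : ℤ) ∣ y then 0
      else neighbourSum f (triangleWave n x) (triangleWave m y) := by
  have hwall {x : ℤ} (hx : (n : ℤ) ∣ x) (y : ℤ) : f (triangleWave n x) y = 0 := by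
    rcases (triangleWave_eq_zero_or_eq_iff hn x).2 hx with h | h <;> simp only [h, hleft, hright]
  have hfloor {y : ℤ} (hy : (m : ℤ) ∣ y) (x : ℤ) : f x (triangleWave m y) = 0 := by
    rcases (triangleWave_eq_zero_or_eq_iff hm y).2 hy with h | h <;> simp only [h, hbase, htop]
  rw [neighbourSum, neighbourSum]
  split_ifs with h
  · rcases h with h | h
    · simp only [triangleWave_add_one_of_dvd hn h, hwall h, CharTwo.add_self_eq_zero]
    · simp only [triangleWave_add_one_of_dvd hm h, hfloor h, zero_add, CharTwo.add_self_eq_zero]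
  · have ⟨hx, hy⟩ := not_or.1 h
    rw [apply_triangleWave_add_one_add_sub_one hn hx (f · (triangleWave m y)), add_assoc,
      apply_triangleWave_add_one_add_sub_one hm hy (f (triangleWave n x)), ← add_assoc]

lemma eq_zero_of_neighbourSum_eq_zero_of_boundary (hm : 0 < m) (hn : 0 < n) (hmn : m.Coprime n)
    {f : ℤ → ℤ → R} (hleft : ∀ y, f 0 y = 0) (hright : ∀ y, f n y = 0) (hbase : ∀ x, f x 0 = 0)
    (htop : ∀ x, f x m = 0)
    (hf : ∀ x y : ℤ, 0 < x → x < n → 0 < y → y < m → Odd (x + y) → neighbourSum f x y = 0)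
    {x y : ℤ} (hx₀ : 0 ≤ x) (hx : x ≤ n) (hy₀ : 0 ≤ y) (hy : y ≤ m) (hxy : Even (x + y)) :
    f x y = 0 := by
  have hwave (x y : ℤ) (hxy : Odd (x + y)) :
      neighbourSum (fun x y => f (triangleWave n x) (triangleWave m y)) x y = 0 := by
    rw [neighbourSum_triangleWave hm hn hleft hright hbase htop]
    split_ifs with h
    · rfl
    · rw [← triangleWave_eq_zero_or_eq_iff hn, ← triangleWave_eq_zero_or_eq_iff hm] at h
      have := triangleWave_mem_Icc hn x
      have := triangleWave_mem_Icc hm y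
      refine hf _ _ (by omega) (by omega) (by omega) (by omega) ?_
      simpa only [← Int.not_even_iff_odd, Int.even_add, even_triangleWave_iff] using hxy
  have hzero (n : ℕ) : triangleWave n 0 = 0 := triangleWave_of_mem_Icc le_rfl n.cast_nonneg
  have hself (n : ℕ) : triangleWave n n = n := triangleWave_of_mem_Icc n.cast_nonneg le_rfl
  have := eq_zero_of_neighbourSum_eq_zero_of_lines (Nat.isCoprime_iff_coprime.2 hmn.symm) hwave
    (by simp only [hzero, hleft, implies_true]) (by simp only [hself, hright, implies_true])
    (by simp only [hzero, hbase, implies_true]) (by simp only [hself, htop, implies_true]) hxy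
  rwa [triangleWave_of_mem_Icc hx₀ hx, triangleWave_of_mem_Icc hy₀ hy] at this

end WaveEquation

/-! ### The puzzle as a system of equations -/

section Puzzle

variable {r c : ℕ} (C : Finset (Square r c))

/-- The number modulo `2` of checkers of `C` at the lattice point `(x, y)`. The square in row `i`
and column `j` is the point `(j + 1, i + 1)`, so that the board fills the interior of the
rectangle of width `c + 1` and height `r + 1`. -/
def checkerAt (x y : ℤ) : ZMod 2 :=
  ∑ d ∈ C, if (d.2.val : ℤ) + 1 = x ∧ (d.1.val : ℤ) + 1 = y then 1 else 0

lemma checkerAt_square (q : Square r c) :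
    checkerAt C (q.2.val + 1) (q.1.val + 1) = if q ∈ C then 1 else 0 := by
  have heq (d : Square r c) :
      ((d.2.val : ℤ) + 1 = q.2.val + 1 ∧ (d.1.val : ℤ) + 1 = q.1.val + 1) ↔ d = q := by
    rw [Prod.ext_iff, Fin.ext_iff, Fin.ext_iff]
    omega
  simp only [checkerAt, heq, sum_ite_eq']

lemma exists_square {x y : ℤ} (hx₀ : 0 < x) (hx : x ≤ c) (hy₀ : 0 < y) (hy : y ≤ r) :
    ∃ q : Square r c, x = q.2.val + 1 ∧ y = q.1.val + 1 :=
  ⟨(⟨(y - 1).toNat, by omega⟩, ⟨(x - 1).toNat, by omega⟩), by dsimp; omega, by dsimp; omega⟩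

lemma checkerAt_outside {x y : ℤ} (h : ¬ (0 < x ∧ x ≤ c ∧ 0 < y ∧ y ≤ r)) :
    checkerAt C x y = 0 := by
  refine sum_eq_zero fun d _ => if_neg ?_
  have := d.1.isLt
  have := d.2.isLt
  omega

lemma sum_checkerAt :
    ∑ y ∈ Icc (1 : ℤ) r, ∑ x ∈ Icc (1 : ℤ) c, checkerAt C x y = C.card := by
  simp only [checkerAt]
  rw [← sum_product', sum_comm, card_eq_sum_ones, Nat.cast_sum]
  refine sum_congr rfl fun d _ => ?_
  rw [sum_eq_single_of_mem ((d.1.val + 1 : ℤ), (d.2.val + 1 : ℤ))]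
  · simp
  · have := d.1.isLt
    have := d.2.isLt
    simp only [mem_product, mem_Icc]
    omega
  · rintro ⟨y, x⟩ - hne
    refine if_neg fun h => hne ?_
    rw [h.1, h.2]

lemma card_filter_neighbour (q : Square r c) :
    ((C.filter fun d => Neighbour q d).card : ZMod 2) =
      neighbourSum (checkerAt C) (q.2.val + 1) (q.1.val + 1) := by
  simp only [neighbourSum, checkerAt, ← sum_add_distrib, natCast_card_filter]
  refine sum_congr rfl fun d _ => ?_
  simp only [Neighbour, Fin.ext_iff]
  split_ifs <;> first | omega | simp

lemma isLight_iff_odd (q : Square r c) :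
    IsLight q ↔ Odd ((q.2.val + 1 : ℤ) + (q.1.val + 1)) := by
  rw [IsLight, IsDark, Nat.not_even_iff, Int.odd_iff]
  omega

lemma isDark_iff_even (q : Square r c) :
    IsDark q ↔ Even ((q.2.val + 1 : ℤ) + (q.1.val + 1)) := by
  rw [IsDark, Nat.even_iff, Int.even_iff]
  omega

lemma odd_iff_mem_bottomRowPuzzle_iff {q : Square r c} (hq : IsLight q) (k : ℕ) :
    (Odd k ↔ q ∈ bottomRowPuzzle r c) ↔
      (k : ZMod 2) = if (q.1.val + 1 : ℤ) = 1 then 1 else 0 := by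
  have hmem : q ∈ bottomRowPuzzle r c ↔ (q.1.val + 1 : ℤ) = 1 := by
    rw [bottomRowPuzzle, mem_filter, and_iff_right (mem_univ q), and_iff_right hq]
    omega
  rw [hmem]
  split_ifs with h
  · simp only [h, iff_true, ZMod.natCast_eq_one_iff_odd]
  · simp only [h, iff_false, Nat.not_odd_iff_even, ZMod.natCast_eq_zero_iff_even]

lemma isSolution_iff :
    IsSolution (bottomRowPuzzle r c) C ↔ (∀ q ∈ C, IsDark q) ∧
      ∀ x y : ℤ, 0 < x → x ≤ c → 0 < y → y ≤ r → Odd (x + y) →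
        neighbourSum (checkerAt C) x y = if y = 1 then 1 else 0 := by
  refine and_congr_right fun _ => ⟨fun h x y hx₀ hx hy₀ hy hodd => ?_, fun h q hq => ?_⟩
  · obtain ⟨q, rfl, rfl⟩ := exists_square hx₀ hx hy₀ hy
    have hq := (isLight_iff_odd q).2 hodd
    rw [← card_filter_neighbour]
    exact (odd_iff_mem_bottomRowPuzzle_iff hq _).1 (h q hq)
  · rw [odd_iff_mem_bottomRowPuzzle_iff hq, card_filter_neighbour]
    have := q.1.isLt
    have := q.2.isLt
    exact h _ _ (by omega) (by omega) (by omega) (by omega) ((isLight_iff_odd q).1 hq)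

lemma eq_of_isSolution {m n : ℕ} (hm : 0 < m) (hn : 0 < n) (hmn : m.Coprime n)
    {C D : Finset (Square (m - 1) (n - 1))}
    (hC : IsSolution (bottomRowPuzzle (m - 1) (n - 1)) C)
    (hD : IsSolution (bottomRowPuzzle (m - 1) (n - 1)) D) : C = D := by
  rw [isSolution_iff] at hC hD
  have houtside (x y : ℤ) (h : ¬ (0 < x ∧ x < n ∧ 0 < y ∧ y < m)) :
      checkerAt C x y - checkerAt D x y = 0 := by
    rw [checkerAt_outside, checkerAt_outside, sub_self] <;> omega
  have hzero (q : Square (m - 1) (n - 1)) (hq : IsDark q) :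
      checkerAt C (q.2.val + 1) (q.1.val + 1) - checkerAt D (q.2.val + 1) (q.1.val + 1) = 0 := by
    refine eq_zero_of_neighbourSum_eq_zero_of_boundary hm hn hmn
      (f := fun x y => checkerAt C x y - checkerAt D x y)
      (fun y => houtside _ _ (by omega)) (fun y => houtside _ _ (by omega))
      (fun x => houtside _ _ (by omega)) (fun x => houtside _ _ (by omega))
      (fun x y hx₀ hx hy₀ hy hodd => ?_) (by omega) (by omega) (by omega) (by omega)
      ((isDark_iff_even q).1 hq)
    have hCxy := hC.2 x y hx₀ (by omega) hy₀ (by omega) hodd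
    have hDxy := hD.2 x y hx₀ (by omega) hy₀ (by omega) hodd
    simp only [neighbourSum] at hCxy hDxy ⊢
    linear_combination hCxy - hDxy
  ext q
  by_cases hq : IsDark q
  · have h := sub_eq_zero.1 (hzero q hq)
    simp only [checkerAt_square] at h
    by_cases hqC : q ∈ C <;> by_cases hqD : q ∈ D <;> simp_all
  · exact iff_of_false (mt (hC.1 q) hq) (mt (hD.1 q) hq)

end Puzzle

/-! ### Existence -/

section Crossings

/-- The label modulo `2` of the line `x - y = 2 * a` on which a segment of the unfolded path of the
ball lies. If the ball goes back and forth along its path, it moves up this line after its `k`-th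
return to the base, where `a = m * k`. The label is the parity of the number of bounces along the
base between this segment and the start of the path: `k` on the way there, and `n - 1 - k` on the
way back. -/
def segmentLabel (m n : ℕ) (a : ZMod n) : ZMod 2 :=
  (min ((m : ZMod n)⁻¹ * a).val (n - 1 - ((m : ZMod n)⁻¹ * a).val) : ℕ)

variable {m n : ℕ}

lemma segmentLabel_mul_natCast (hmn : m.Coprime n) {k : ℕ} (hk : k < n) :
    segmentLabel m n (m * k) = (min k (n - 1 - k) : ℕ) := by
  rw [segmentLabel, ← mul_assoc, mul_comm _ (m : ZMod n), ZMod.coe_mul_inv_eq_one m hmn, one_mul,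
    ZMod.val_cast_of_lt hk]

lemma exists_lt_eq_mul_natCast (hn : 0 < n) (hmn : m.Coprime n) (a : ZMod n) :
    ∃ k < n, a = m * k := by
  have : NeZero n := ⟨hn.ne'⟩
  refine ⟨((m : ZMod n)⁻¹ * a).val, ZMod.val_lt _, ?_⟩
  rw [ZMod.natCast_zmod_val, ← mul_assoc, ZMod.coe_mul_inv_eq_one m hmn, one_mul]

lemma segmentLabel_neg_sub (hn : 0 < n) (hmn : m.Coprime n) (a : ZMod n) :
    segmentLabel m n (-m - a) = segmentLabel m n a := by
  obtain ⟨k, hk, rfl⟩ := exists_lt_eq_mul_natCast hn hmn a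
  have hreflect : (-m - m * k : ZMod n) = m * (n - 1 - k : ℕ) := by
    rw [Nat.sub_sub, Nat.cast_sub (by omega), ZMod.natCast_self]
    push_cast
    ring
  rw [hreflect, segmentLabel_mul_natCast hmn hk, segmentLabel_mul_natCast hmn (by omega)]
  congr 1
  omega

lemma segmentLabel_add_segmentLabel_neg (hn : 0 < n) (hmn : m.Coprime n) {a : ZMod n}
    (ha : 2 * a ≠ 0) : segmentLabel m n a + segmentLabel m n (-a) = 1 := by
  obtain ⟨k, hk, rfl⟩ := exists_lt_eq_mul_natCast hn hmn a
  have hk₀ : k ≠ 0 := by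
    rintro rfl
    simp at ha
  have hk₂ : 2 * k ≠ n := fun h => ha <| by
    rw [mul_left_comm, ← Nat.cast_ofNat, ← Nat.cast_mul 2 k, h, ZMod.natCast_self, mul_zero]
  have hneg : (-(m * k) : ZMod n) = m * (n - k : ℕ) := by
    rw [Nat.cast_sub hk.le, ZMod.natCast_self]
    ring
  rw [hneg, segmentLabel_mul_natCast hmn hk, segmentLabel_mul_natCast hmn (by omega),
    ← Nat.cast_add, ZMod.natCast_eq_one_iff_odd, Nat.odd_iff]
  omega

/-- The sum of the labels of the two segments of the path of the ball that cross at `(x, y)`, for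
even `x + y`; it is `1` where these labels differ. -/
def crossing (m n : ℕ) (x y : ℤ) : ZMod 2 :=
  segmentLabel m n ((x - y) / 2 : ℤ) + segmentLabel m n ((-x - y) / 2 : ℤ)

lemma neighbourSum_crossing (m n : ℕ) (x y : ℤ) : neighbourSum (crossing m n) x y = 0 := by
  simp only [neighbourSum, crossing, show x + 1 - y = x - (y - 1) by ring,
    show x - 1 - y = x - (y + 1) by ring, show -(x + 1) - y = -x - (y + 1) by ring,
    show -(x - 1) - y = -x - (y - 1) by ring]
  generalize segmentLabel m n _ = a, segmentLabel m n _ = b, segmentLabel m n _ = c,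
    segmentLabel m n _ = d
  linear_combination (a + b + c + d) * (CharTwo.two_eq_zero (R := ZMod 2))

lemma crossing_base (hn : 0 < n) (hmn : m.Coprime n) {x : ℤ} (hx : Even x) (hx₀ : 0 < x)
    (hxn : x < n) : crossing m n x 0 = 1 := by
  obtain ⟨a, rfl⟩ := hx
  rw [crossing, show (a + a - 0) / 2 = a by omega, show (-(a + a) - 0) / 2 = -a by omega,
    Int.cast_neg]
  refine segmentLabel_add_segmentLabel_neg hn hmn fun h => ?_
  have hdvd : (n : ℤ) ∣ 2 * a := (ZMod.intCast_zmod_eq_zero_iff_dvd _ n).1 (by exact_mod_cast h)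
  have := Int.le_of_dvd (by omega) hdvd
  omega

lemma crossing_left (m n : ℕ) (y : ℤ) : crossing m n 0 y = 0 := by
  rw [crossing, neg_zero, CharTwo.add_self_eq_zero]

lemma crossing_right (m n : ℕ) (y : ℤ) : crossing m n n y = 0 := by
  rw [crossing, show ((n : ℤ) - y) / 2 = (-n - y) / 2 + n by omega, Int.cast_add, Int.cast_natCast,
    ZMod.natCast_self, add_zero, CharTwo.add_self_eq_zero]

lemma crossing_top (hn : 0 < n) (hmn : m.Coprime n) {x : ℤ} (hx : Even (x + m)) :
    crossing m n x m = 0 := by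
  rw [Int.even_iff] at hx
  rw [crossing, show (-x - (m : ℤ)) / 2 = -m - (x - m) / 2 by omega, Int.cast_sub, Int.cast_neg,
    Int.cast_natCast, segmentLabel_neg_sub hn hmn, CharTwo.add_self_eq_zero]

/-- The dark squares at which segments of the path of the ball with different labels cross. -/
def crossingSet (m n : ℕ) : Finset (Square (m - 1) (n - 1)) :=
  Finset.univ.filter fun q => IsDark q ∧ crossing m n (q.2.val + 1) (q.1.val + 1) = 1

lemma checkerAt_crossingSet_of_mem_Ioo {x y : ℤ} (hx₀ : 0 < x) (hx : x < n) (hy₀ : 0 < y)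
    (hy : y < m) :
    checkerAt (crossingSet m n) x y = if Even (x + y) then crossing m n x y else 0 := by
  obtain ⟨q, rfl, rfl⟩ :=
    exists_square (r := m - 1) (c := n - 1) hx₀ (by omega) hy₀ (by omega)
  simp only [checkerAt_square, crossingSet, mem_filter, mem_univ, true_and, isDark_iff_even,
    ite_and]
  generalize crossing m n _ _ = a
  revert a
  split_ifs <;> decide

lemma checkerAt_crossingSet (hn : 0 < n) (hmn : m.Coprime n) {x y : ℤ} (hxy : Even (x + y))
    (hx₀ : 0 ≤ x) (hx : x ≤ n) (hy₀ : 0 ≤ y) (hy : y ≤ m)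
    (hcorner : 0 < x ∧ x < n ∨ 0 < y ∧ y < m) :
    checkerAt (crossingSet m n) x y = crossing m n x y + if y = 0 then 1 else 0 := by
  by_cases hin : 0 < x ∧ x < n ∧ 0 < y ∧ y < m
  · obtain ⟨hx₀, hx, hy₀, hy⟩ := hin
    rw [checkerAt_crossingSet_of_mem_Ioo hx₀ hx hy₀ hy, if_pos hxy, if_neg hy₀.ne', add_zero]
  rw [checkerAt_outside _ (by omega)]
  rcases hy₀.eq_or_lt with rfl | hy₀
  · rw [crossing_base hn hmn (by simpa using hxy) (by omega) (by omega), if_pos rfl,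
      CharTwo.add_self_eq_zero]
  rw [if_neg hy₀.ne', add_zero]
  rcases hy.eq_or_lt with rfl | hy
  · exact (crossing_top hn hmn hxy).symm
  rcases hx₀.eq_or_lt with rfl | hx₀
  · exact (crossing_left m n y).symm
  obtain rfl : x = n := by omega
  exact (crossing_right m n y).symm

theorem isSolution_crossingSet (hn : 0 < n) (hmn : m.Coprime n) :
    IsSolution (bottomRowPuzzle (m - 1) (n - 1)) (crossingSet m n) := by
  rw [isSolution_iff]
  refine ⟨fun q hq => (mem_filter.1 hq).2.1, fun x y hx₀ hx hy₀ hy hodd => ?_⟩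
  have hwave := neighbourSum_crossing m n x y
  obtain ⟨s, hs⟩ := hodd
  have hcheck {x' y' : ℤ} (hxy : Even (x' + y')) := checkerAt_crossingSet hn hmn hxy
  rw [neighbourSum] at hwave ⊢
  rw [hcheck ⟨s + 1, by omega⟩, hcheck ⟨s, by omega⟩, hcheck ⟨s + 1, by omega⟩,
    hcheck ⟨s, by omega⟩, if_neg hy₀.ne', if_neg (by omega : ¬ y + 1 = 0)]
  · simp only [sub_eq_zero]
    linear_combination hwave
  all_goals omega

end Crossings

/-! ### The number of checkers -/

section PairCounting

lemma sum_card_filter_lt_add_sum_card_filter_lt {α : Type*} [LinearOrder α] {S T : Finset α}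
    (hST : Disjoint S T) :
    ∑ s ∈ S, (T.filter (· < s)).card + ∑ t ∈ T, (S.filter (· < t)).card = S.card * T.card := by
  have hswap : ∑ t ∈ T, (S.filter (· < t)).card = ∑ s ∈ S, (T.filter (s < ·)).card :=
    (sum_card_bipartiteAbove_eq_sum_card_bipartiteBelow (· < ·)).symm
  rw [hswap, ← sum_add_distrib, ← smul_eq_mul, ← sum_const]
  refine sum_congr rfl fun s hs => ?_
  have hgt : T.filter (s < ·) = T.filter (¬ · < s) := filter_congr fun t ht =>
    ⟨fun h => h.not_gt, fun h => (not_lt.1 h).lt_of_ne (hST.forall_ne_finset hs ht)⟩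
  rw [hgt, card_filter_add_card_filter_not]

lemma card_multiplesBelow (a N : ℕ) : (multiplesBelow a N).card = (N - 1) / a := by
  rw [← Nat.Ioc_filter_dvd_card_eq_div, Ioc_sub_one_right_eq_Ioo, multiplesBelow]

lemma card_filter_lt_multiplesBelow {a N t : ℕ} (htN : t ≤ N) (hat : ¬ a ∣ t) :
    ((multiplesBelow a N).filter (· < t)).card = t / a := by
  rw [← Nat.Ioc_filter_dvd_card_eq_div]
  congr 1
  ext s
  simp only [mem_filter, mem_multiplesBelow, mem_Ioc]
  refine ⟨fun ⟨⟨⟨h₀, _⟩, hdvd⟩, hlt⟩ => ⟨⟨h₀, hlt.le⟩, hdvd⟩, fun ⟨⟨h₀, hle⟩, hdvd⟩ => ?_⟩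
  have hlt : s < t := hle.lt_of_ne fun h => hat (h ▸ hdvd)
  exact ⟨⟨⟨h₀, hlt.trans_le htN⟩, hdvd⟩, hlt⟩

variable {m n : ℕ}

lemma not_dvd_of_mem_multiplesBelow (hmn : m.Coprime n) {t : ℕ}
    (ht : t ∈ multiplesBelow n (m * n)) : ¬ m ∣ t := fun hdvd => by
  obtain ⟨⟨ht₀, ht⟩, hnt⟩ := mem_multiplesBelow.1 ht
  exact (Nat.le_of_dvd ht₀ (hmn.mul_dvd_of_dvd_of_dvd hdvd hnt)).not_gt ht

lemma sum_div_add_sum_div (hm : 0 < m) (hn : 0 < n) (hmn : m.Coprime n) :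
    ∑ t ∈ multiplesBelow (2 * m) (m * n), t / n + ∑ t ∈ multiplesBelow n (m * n), t / (2 * m) =
      (n - 1) / 2 * (m - 1) := by
  have hnot {t : ℕ} (ht : t ∈ multiplesBelow n (m * n)) : ¬ 2 * m ∣ t := fun hdvd =>
    not_dvd_of_mem_multiplesBelow hmn ht (dvd_of_mul_left_dvd hdvd)
  have hdisj : Disjoint (multiplesBelow (2 * m) (m * n)) (multiplesBelow n (m * n)) :=
    disjoint_right.2 fun t ht ht' => hnot ht (mem_multiplesBelow.1 ht').2
  have hdiv {a b : ℕ} (ha : 0 < a) (hb : 0 < b) : (a * b - 1) / a = b - 1 := by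
    simpa using Nat.mul_sub_div 0 a b (by positivity)
  have hcard : (n - 1) / 2 * (m - 1) =
      (multiplesBelow (2 * m) (m * n)).card * (multiplesBelow n (m * n)).card := by
    rw [card_multiplesBelow, card_multiplesBelow, mul_comm 2 m, ← Nat.div_div_eq_div_mul,
      hdiv hm hn, mul_comm m n, hdiv hn hm]
  rw [hcard, ← sum_card_filter_lt_add_sum_card_filter_lt hdisj]
  congr 1 <;> refine sum_congr rfl fun t ht => (card_filter_lt_multiplesBelow ?_ ?_).symm
  · exact (mem_multiplesBelow.1 ht).1.2.le
  · exact fun hdvd => disjoint_left.1 hdisj ht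
      (mem_multiplesBelow.2 ⟨(mem_multiplesBelow.1 ht).1, hdvd⟩)
  · exact (mem_multiplesBelow.1 ht).1.2.le
  · exact hnot ht

end PairCounting

section RowSums

variable {m n : ℕ}

lemma sum_Ioc_neg_eq {A : Type*} [AddCommMonoid A] (hn : 0 < n) (g : ℤ → A) :
    ∑ x ∈ Ioc (-n : ℤ) n, g x = ∑ x ∈ Ioo (0 : ℤ) n, (g x + g (-x)) + ∑ x ∈ {0, (n : ℤ)}, g x := by
  have hsplit : Ioc (-n : ℤ) n = (Ioo 0 ↑n ∪ (Ioo (0 : ℤ) n).image Neg.neg) ∪ {0, ↑n} := by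
    ext x
    simp only [mem_Ioc, mem_union, mem_Ioo, mem_image, mem_insert, mem_singleton,
      neg_eq_iff_eq_neg, exists_eq_right]
    omega
  rw [hsplit, sum_union, sum_union, sum_image neg_injective.injOn, ← sum_add_distrib]
  all_goals
    rw [disjoint_left]
    simp only [mem_union, mem_Ioo, mem_image, mem_insert, mem_singleton, neg_eq_iff_eq_neg,
      exists_eq_right]
    omega

lemma sum_Ioc_filter_even_eq_sum_univ {A : Type*} [AddCommMonoid A] [NeZero n] (f : ZMod n → A)
    (y : ℤ) :
    ∑ x ∈ (Ioc (-n : ℤ) n).filter (fun x => Even (x + y)), f ((x - y) / 2 : ℤ) = ∑ a, f a := by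
  have hn := NeZero.pos n
  refine sum_nbij (fun x => ((x - y) / 2 : ℤ)) (fun x _ => mem_univ _) ?_ ?_ fun x _ => rfl
  · intro x hx x' hx' h
    simp only [coe_filter, mem_Ioc, Set.mem_ofPred_eq, Int.even_iff] at hx hx'
    have hdvd : (n : ℤ) ∣ (x - y) / 2 - (x' - y) / 2 := by
      rwa [← ZMod.intCast_zmod_eq_zero_iff_dvd, Int.cast_sub, sub_eq_zero]
    have := Int.eq_zero_of_abs_lt_dvd hdvd (abs_lt.2 (by omega))
    omega
  · intro a _
    obtain ⟨v, rfl⟩ := ZMod.intCast_surjective a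
    have hmod := Int.mul_ediv_add_emod (n - y - 2 * v) (2 * n)
    set q := (n - y - 2 * v) / (2 * n)
    have hr₀ := Int.emod_nonneg (n - y - 2 * v) (b := 2 * n) (by omega)
    have hr := Int.emod_lt_of_pos (n - y - 2 * v) (b := 2 * n) (by omega)
    refine ⟨y + 2 * (v + n * q), ?_, ?_⟩
    · simp only [coe_filter, mem_Ioc, Set.mem_ofPred_eq]
      exact ⟨by constructor <;> linarith, ⟨y + (v + n * q), by ring⟩⟩
    · simp

lemma sum_crossing_row [NeZero n] (y : ℤ) :
    ∑ x ∈ Ioo (0 : ℤ) n, (if Even (x + y) then crossing m n x y else 0) =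
      ∑ a, segmentLabel m n a +
        ∑ x ∈ {0, (n : ℤ)}, if Even (x + y) then segmentLabel m n ((x - y) / 2 : ℤ) else 0 := by
  rw [← sum_Ioc_filter_even_eq_sum_univ _ y, sum_filter, sum_Ioc_neg_eq (NeZero.pos n), add_assoc,
    CharTwo.add_self_eq_zero, add_zero]
  refine sum_congr rfl fun x _ => ?_
  have hneg : Even (-x + y) ↔ Even (x + y) := by simp only [Int.even_add, even_neg]
  simp only [hneg, crossing]
  split_ifs <;> simp

/-- The points at which the ball bounces at the vertical sides of the rectangle. -/
noncomputable def wallPoints (m n : ℕ) : Finset (ℤ × ℤ) :=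
  (({0, (n : ℤ)} : Finset ℤ) ×ˢ Ioo 0 (m : ℤ)).filter fun p => Even (p.1 + p.2)

lemma card_crossingSet (hm : 0 < m) [NeZero n] :
    ((crossingSet m n).card : ZMod 2) = (m - 1 : ℕ) * ∑ a, segmentLabel m n a +
      ∑ p ∈ wallPoints m n, segmentLabel m n ((p.1 - p.2) / 2 : ℤ) := by
  have hIoo {k : ℕ} (hk : 0 < k) : Icc 1 ((k - 1 : ℕ) : ℤ) = Ioo 0 (k : ℤ) := by
    ext
    simp only [mem_Icc, mem_Ioo]
    omega
  have hrow : ∀ y ∈ Ioo (0 : ℤ) m, ∑ x ∈ Ioo (0 : ℤ) n, checkerAt (crossingSet m n) x y =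
      ∑ a, segmentLabel m n a +
        ∑ x ∈ {0, (n : ℤ)}, if Even (x + y) then segmentLabel m n ((x - y) / 2 : ℤ) else 0 := by
    intro y hy
    have ⟨hy₀, hym⟩ := mem_Ioo.1 hy
    rw [← sum_crossing_row]
    refine sum_congr rfl fun x hx => ?_
    have ⟨hx₀, hxn⟩ := mem_Ioo.1 hx
    exact checkerAt_crossingSet_of_mem_Ioo hx₀ hxn hy₀ hym
  rw [← sum_checkerAt, hIoo hm, hIoo (NeZero.pos n), sum_congr rfl hrow, sum_add_distrib, sum_const,
    Int.card_Ioo, nsmul_eq_mul, wallPoints, sum_filter, sum_product_right]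
  congr 3
  omega

lemma sum_segmentLabel (hmn : m.Coprime n) [NeZero n] (hodd : Odd n) :
    ∑ a, segmentLabel m n a = ((n - 1) / 2 : ℕ) := by
  obtain ⟨k, rfl⟩ := hodd
  have hn : (2 * k + 1 : ZMod (2 * k + 1)) = 0 := by
    exact_mod_cast ZMod.natCast_self (2 * k + 1)
  have htwo : IsUnit (2 : ZMod (2 * k + 1)) :=
    IsUnit.of_mul_eq_one (-k) (by linear_combination -hn)
  rw [← add_sum_erase _ _ (mem_univ (m * k : ZMod (2 * k + 1))),
    segmentLabel_mul_natCast hmn (by omega),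
    sum_involution (fun a _ => (-m - a : ZMod (2 * k + 1)))]
  · rw [add_zero]
    congr 1
    omega
  · intro a _
    rw [segmentLabel_neg_sub (by omega) hmn, CharTwo.add_self_eq_zero]
  · intro a ha _ h
    exact ne_of_mem_erase ha <| htwo.mul_left_cancel <| by linear_combination -h - m * hn
  · intro a ha
    refine mem_erase.2 ⟨fun h => ne_of_mem_erase ha ?_, mem_univ _⟩
    linear_combination -h - m * hn
  · intro a _
    exact sub_sub_cancel _ _

end RowSums

section WallBounces

variable {m n : ℕ}

lemma triangleWave_triangleWave_of_dvd (hn : 0 < n) {N : ℕ} (h : n ∣ N) (t : ℤ) :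
    triangleWave n (triangleWave N t) = triangleWave n t := by
  have hdvd : (2 * n : ℤ) ∣ 2 * N := mul_dvd_mul_left 2 (Int.natCast_dvd_natCast.2 h)
  exact (triangleWave_eq_triangleWave_iff hn).2 <|
    (two_mul_dvd_triangleWave_sub_or_add N t).imp hdvd.trans hdvd.trans

lemma exists_triangleWave_eq (hm : 0 < m) (hn : 0 < n) (hmn : m.Coprime n) {x y : ℤ}
    (hx₀ : 0 ≤ x) (hx : x ≤ n) (hy₀ : 0 ≤ y) (hy : y ≤ m) (hxy : Even (x + y)) :
    ∃ t : ℤ, triangleWave n t = x ∧ triangleWave m t = y := by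
  obtain ⟨a, b, hab⟩ := Nat.isCoprime_iff_coprime.2 hmn
  obtain ⟨e, he⟩ := hxy
  refine ⟨y + 2 * m * a * (e - y), (triangleWave_eq_iff hn hx₀ hx).2 (.inl ⟨-b * (e - y), ?_⟩),
    (triangleWave_eq_iff hm hy₀ hy).2 (.inl ⟨a * (e - y), ?_⟩)⟩
  · linear_combination 2 * (e - y) * hab - he
  · ring

lemma two_mul_dvd_sub_iff_two_mul_dvd_add {s t : ℤ} (ht : (n : ℤ) ∣ t) :
    (2 * n : ℤ) ∣ s - t ↔ (2 * n : ℤ) ∣ s + t := by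
  rw [show s + t = s - t + 2 * t by ring, dvd_add_left (mul_dvd_mul_left 2 ht)]

lemma eq_of_triangleWave_eq (hm : 0 < m) (hn : 0 < n) (hmn : m.Coprime n) {s t : ℤ}
    (hs : 0 ≤ s ∧ s ≤ (m * n : ℕ)) (ht : 0 ≤ t ∧ t ≤ (m * n : ℕ)) (hnt : (n : ℤ) ∣ t)
    (hx : triangleWave n s = triangleWave n t) (hy : triangleWave m s = triangleWave m t) :
    s = t := by
  rw [triangleWave_eq_triangleWave_iff hn, two_mul_dvd_sub_iff_two_mul_dvd_add hnt, or_self] at hx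
  have hx' := (two_mul_dvd_sub_iff_two_mul_dvd_add hnt).2 hx
  rw [triangleWave_eq_triangleWave_iff hm] at hy
  have hlcm {u : ℤ} (hmu : (2 * m : ℤ) ∣ u) (hnu : (2 * n : ℤ) ∣ u) :
      (2 * (m * n : ℕ) : ℤ) ∣ u := by
    obtain ⟨v, rfl⟩ := dvd_of_mul_right_dvd hmu
    rw [mul_dvd_mul_iff_left two_ne_zero] at hmu hnu ⊢
    rw [Nat.cast_mul]
    exact (Nat.isCoprime_iff_coprime.2 hmn).mul_dvd hmu hnu
  exact eq_of_two_mul_dvd_sub_or_add hs.1 hs.2 ht.1 ht.2 (hy.imp (hlcm · hx') (hlcm · hx))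

lemma exists_mem_multiplesBelow_of_mem_wallPoints (hm : 0 < m) (hn : 0 < n) (hmn : m.Coprime n)
    {p : ℤ × ℤ} (hp : p ∈ wallPoints m n) :
    ∃ t ∈ multiplesBelow n (m * n), (triangleWave n t, triangleWave m t) = p := by
  obtain ⟨x, y⟩ := p
  simp only [wallPoints, mem_filter, mem_product, mem_insert, mem_singleton, mem_Ioo] at hp
  obtain ⟨⟨hx, hy₀, hym⟩, hxy⟩ := hp
  obtain ⟨t₀, rfl, rfl⟩ :=
    exists_triangleWave_eq hm hn hmn (by omega) (by omega) hy₀.le hym.le hxy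
  have ht := triangleWave_mem_Icc (Nat.mul_pos hm hn) t₀
  obtain ⟨t, ht₀⟩ := Int.eq_ofNat_of_zero_le ht.1
  have hwave_n : triangleWave n t = triangleWave n t₀ := by
    rw [← ht₀, triangleWave_triangleWave_of_dvd hn (dvd_mul_left n m)]
  have hwave_m : triangleWave m t = triangleWave m t₀ := by
    rw [← ht₀, triangleWave_triangleWave_of_dvd hm (dvd_mul_right m n)]
  have hnt : n ∣ t := by
    rwa [← Int.natCast_dvd_natCast, ← triangleWave_eq_zero_or_eq_iff hn, hwave_n]
  have hmt : ¬ m ∣ t := by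
    rw [← Int.natCast_dvd_natCast, ← triangleWave_eq_zero_or_eq_iff hm, hwave_m]
    omega
  refine ⟨t, mem_multiplesBelow.2 ⟨⟨?_, ?_⟩, hnt⟩, Prod.ext hwave_n hwave_m⟩
  · exact Nat.pos_of_ne_zero fun h => hmt (h ▸ dvd_zero m)
  · exact lt_of_le_of_ne (by omega) fun h => hmt (h ▸ dvd_mul_right m n)

lemma bijOn_multiplesBelow_wallPoints (hm : 0 < m) (hn : 0 < n) (hmn : m.Coprime n) :
    Set.BijOn (fun t : ℕ => (triangleWave n t, triangleWave m t)) (multiplesBelow n (m * n))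
      (wallPoints m n) := by
  refine ⟨fun t ht => ?_, fun s hs t ht hst => ?_,
    fun p hp => exists_mem_multiplesBelow_of_mem_wallPoints hm hn hmn hp⟩
  · have hmt := not_dvd_of_mem_multiplesBelow hmn ht
    have hnt := (mem_multiplesBelow.1 ht).2
    rw [← Int.natCast_dvd_natCast, ← triangleWave_eq_zero_or_eq_iff hm] at hmt
    rw [← Int.natCast_dvd_natCast, ← triangleWave_eq_zero_or_eq_iff hn] at hnt
    have := triangleWave_mem_Icc hm t
    simp only [wallPoints, coe_filter, mem_product, mem_insert, mem_singleton, mem_Ioo,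
      Set.mem_ofPred_eq, Int.even_add, even_triangleWave_iff, and_true]
    exact ⟨hnt, by omega⟩
  · have ⟨⟨_, hs⟩, _⟩ := mem_multiplesBelow.1 hs
    have ⟨⟨_, ht⟩, hnt⟩ := mem_multiplesBelow.1 ht
    have ⟨hx, hy⟩ := Prod.ext_iff.1 hst
    exact_mod_cast eq_of_triangleWave_eq hm hn hmn ⟨s.cast_nonneg, by exact_mod_cast hs.le⟩
      ⟨t.cast_nonneg, by exact_mod_cast ht.le⟩ (Int.natCast_dvd_natCast.2 hnt) hx hy

lemma triangleWave_natCast_eq (hm : 0 < m) (t : ℕ) :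
    triangleWave m t = t - 2 * m * (t / (2 * m) : ℕ) ∨
      triangleWave m t = 2 * m * ((t / (2 * m) : ℕ) + 1) - t := by
  have hr := Nat.mod_lt t (y := 2 * m) (by positivity)
  have hdiv : (t : ℤ) = 2 * m * (t / (2 * m) : ℕ) + (t % (2 * m) : ℕ) := by
    exact_mod_cast (Nat.div_add_mod t (2 * m)).symm
  set k := t / (2 * m)
  set r := t % (2 * m)
  rcases le_or_gt r m with hrm | hrm
  · left
    rw [hdiv, show (2 * m * k + r : ℤ) = m * (2 * k) + r by ring,
      triangleWave_mul_add _ (by omega) (by omega), if_pos (even_two_mul _)]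
    ring
  · right
    rw [hdiv, show (2 * m * k + r : ℤ) = m * (2 * k + 1) + (r - m) by ring,
      triangleWave_mul_add _ (by omega) (by omega), if_neg (by simp [parity_simps])]
    ring

lemma segmentLabel_wallPoint (hm : 0 < m) (hn : 0 < n) (hmn : m.Coprime n) {t : ℕ}
    (ht : t ∈ multiplesBelow n (m * n)) :
    segmentLabel m n ((triangleWave n t - triangleWave m t) / 2 : ℤ) = (t / (2 * m) : ℕ) := by
  obtain ⟨⟨_, htN⟩, hnt⟩ := mem_multiplesBelow.1 ht
  have hlabel : segmentLabel m n (m * (t / (2 * m) : ℕ)) = (t / (2 * m) : ℕ) := by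
    have hk : t / (2 * m) * 2 < n := by
      have := Nat.div_mul_le_self t (2 * m)
      nlinarith
    rw [segmentLabel_mul_natCast hmn (by omega), min_eq_left (by omega)]
  have hiff := two_mul_dvd_sub_iff_two_mul_dvd_add (s := triangleWave n t)
    (Int.natCast_dvd_natCast.2 hnt)
  have hadd : (2 * n : ℤ) ∣ triangleWave n t + t := by
    simpa only [hiff, or_self] using two_mul_dvd_triangleWave_sub_or_add n t
  set k := t / (2 * m)
  rcases triangleWave_natCast_eq hm t with h | h
  · obtain ⟨c, hc⟩ := hiff.2 hadd
    rw [h, show triangleWave n t - (t - 2 * m * k) = 2 * (m * k + n * c) by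
      linear_combination hc, Int.mul_ediv_cancel_left _ two_ne_zero, ← hlabel]
    simp
  · obtain ⟨c, hc⟩ := hadd
    rw [h, show triangleWave n t - (2 * m * (k + 1) - t) = 2 * (-m - m * k + n * c) by
      linear_combination hc, Int.mul_ediv_cancel_left _ two_ne_zero, ← hlabel,
      ← segmentLabel_neg_sub hn hmn]
    simp

lemma sum_wallPoints_segmentLabel (hm : 0 < m) (hn : 0 < n) (hmn : m.Coprime n) :
    ∑ p ∈ wallPoints m n, segmentLabel m n ((p.1 - p.2) / 2 : ℤ) =
      (∑ t ∈ multiplesBelow n (m * n), t / (2 * m) : ℕ) := by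
  have hbij := bijOn_multiplesBelow_wallPoints hm hn hmn
  rw [Nat.cast_sum]
  exact (sum_nbij _ hbij.mapsTo hbij.injOn hbij.surjOn fun t ht =>
    (segmentLabel_wallPoint hm hn hmn ht).symm).symm

end WallBounces

theorem card_crossingSet_eq {m n : ℕ} (hm : 0 < m) (hn : 0 < n) (hmn : m.Coprime n) :
    ((crossingSet m n).card : ZMod 2) =
      (∑ t ∈ multiplesBelow (2 * m) (m * n), t / n : ℕ) := by
  have : NeZero n := ⟨hn.ne'⟩
  have hrows : ((m - 1 : ℕ) * ∑ a, segmentLabel m n a : ZMod 2) = ((n - 1) / 2 * (m - 1) : ℕ) := by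
    rcases Nat.even_or_odd m with hm_even | hm_odd
    · have hn_odd : Odd n := Nat.Coprime.odd_of_left (hmn.coprime_dvd_left hm_even.two_dvd)
      rw [sum_segmentLabel hmn hn_odd, Nat.cast_mul, mul_comm]
    · have : ((m - 1 : ℕ) : ZMod 2) = 0 :=
        ZMod.natCast_eq_zero_iff_even.2 (Nat.Odd.sub_odd hm_odd odd_one)
      rw [Nat.cast_mul, this, zero_mul, mul_zero]
  rw [card_crossingSet hm, hrows, sum_wallPoints_segmentLabel hm hn hmn,
    ← sum_div_add_sum_div hm hn hmn, Nat.cast_add, add_assoc, CharTwo.add_self_eq_zero, add_zero]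

theorem mainTheorem3 (m n : ℕ) (hm : 0 < m) (hn : 0 < n) (hmn : Nat.Coprime m n) :
    (∃! C : Finset (Square (m - 1) (n - 1)), IsSolution (bottomRowPuzzle (m - 1) (n - 1)) C) ∧
    ∀ C : Finset (Square (m - 1) (n - 1)), IsSolution (bottomRowPuzzle (m - 1) (n - 1)) C →
      billiardSymbol m n = (-1) ^ C.card := by
  have hsol := isSolution_crossingSet hn hmn
  refine ⟨⟨crossingSet m n, hsol, fun C hC => eq_of_isSolution hm hn hmn hC hsol⟩, fun C hC => ?_⟩
  have hcard := (ZMod.natCast_eq_natCast_iff' _ _ 2).1 (card_crossingSet_eq hm hn hmn)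
  rw [eq_of_isSolution hm hn hmn hC hsol, billiardSymbol_eq hm hn hmn, neg_one_pow_eq_pow_mod_two,
    ← hcard, ← neg_one_pow_eq_pow_mod_two]
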